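/- Let $(\Omega,\mathcal F,\mathbb P)$ be a non-atomic probability space which is countably separated modulo null sets, i.e. there are a set $\Omega_0$ of full measure and countably many measurable sets that separate the points of $\Omega_0$ (every standard probability space has this property). Let $\theta,\tau:\Omega\to\Omega$ be measurable maps preserving $\mathbb P$ with $\theta\tau=\tau\theta$ a.e., which generate a free $\mathbb N_0^2$-action: for all $(j,k)\neq(j',k')$ in $\mathbb N_0^2$, the set $\{x:\theta^j\tau^kx=\theta^{j'}\tau^{k'}x\}$ is null. Let $1\le p<\infty$, and let $Uf=f\circ\theta$ and $Vf=f\circ\tau$ be the induced isometric operators on the complex space $X=L_p(\Omega,\mathbb P)$. The (Harte) joint spectrum $\sigma(U,V)$ is the set of all $(\lambda,\nu)\in\mathbb C^2$ such that at least one of the equations $$A_1(\lambda I-U)+A_2(\nu I-V)=I,\qquad (\lambda I-U)B_1+(\nu I-V)B_2=I$$ has no solution in bounded linear operators $A_1,A_2$, respectively $B_1,B_2$, on $X$. Let $\mathbb T=\{z\in\mathbb C:|z|=1\}$. Then $\mathbb T\times\mathbb T\subset\sigma(U,V)$. If moreover $\theta$ and $\tau$ are invertible (each has a measure-preserving inverse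 modulo null sets), then $\sigma(U,V)=\mathbb T\times\mathbb T$. -/

import Mathlib

open MeasureTheory
open scoped ENNReal

/-- The Harte joint spectrum of a finite family `T` of bounded operators on a complex normed
space `X`, relative to the algebra of all bounded operators on `X`: the set of `lam ∈ ℂ^ι` such
that at least one of the equations `∑ A i (lam i - T i) = 1` and `∑ (lam i - T i) B i = 1` has
no solution. -/
def harteSpectrum {ι : Type*} [Fintype ι] {X : Type*} [NormedAddCommGroup X] [NormedSpace ℂ X]
    (T : ι → X →L[ℂ] X) : Set (ι → ℂ) :=
  {lam | (¬ ∃ A : ι → X →L[ℂ] X, ∑ i, A i * (lam i • (1 : X →L[ℂ] X) - T i) = 1) ∨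
         (¬ ∃ B : ι → X →L[ℂ] X, ∑ i, (lam i • (1 : X →L[ℂ] X) - T i) * B i = 1)}

section
variable {Ω : Type*} [MeasurableSpace Ω]

/-- `μ` is non-atomic: each measurable set of positive measure has a measurable subset of
strictly smaller positive measure. -/
def IsNonatomic (μ : Measure Ω) : Prop :=
  ∀ A : Set Ω, MeasurableSet A → 0 < μ A → ∃ B ⊆ A, MeasurableSet B ∧ 0 < μ B ∧ μ B < μ A

/-- Some countable family of measurable sets separates the points of a set of full measure. This
holds for every Borel measure on a standard Borel space, and for its completion. -/
def IsCountablySeparatedModNull (μ : Measure Ω) : Prop :=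
  ∃ Ω₀ : Set Ω, (∀ᵐ x ∂μ, x ∈ Ω₀) ∧ HasCountableSeparatingOn Ω MeasurableSet Ω₀

/-- The `ℕ²`-action `(j, k) ↦ θ^j τ^k` is free: for distinct `m, n ∈ ℕ²`, the points `x` that
have the same image under `m` and `n` form a null set. -/
def IsFreeAction (μ : Measure Ω) (θ τ : Ω → Ω) : Prop :=
  ∀ m n : ℕ × ℕ, m ≠ n → ∀ᵐ x ∂μ, θ^[m.1] (τ^[m.2] x) ≠ θ^[n.1] (τ^[n.2] x)

/-- `θ` is invertible (modulo null sets) as a measure-preserving transformation. -/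
def IsInvertibleMod (μ : Measure Ω) (θ : Ω → Ω) : Prop :=
  ∃ η : Ω → Ω, MeasurePreserving η μ μ ∧ (∀ᵐ x ∂μ, η (θ x) = x) ∧ (∀ᵐ x ∂μ, θ (η x) = x)

/-- The isometric operator `f ↦ f ∘ θ` on the complex space `L_p(μ)`. -/
noncomputable def koopman {μ : Measure Ω} (p : ℝ≥0∞) [Fact (1 ≤ p)] {θ : Ω → Ω}
    (hθ : MeasurePreserving θ μ μ) : Lp ℂ p μ →L[ℂ] Lp ℂ p μ :=
  (Lp.compMeasurePreservingₗᵢ ℂ θ hθ).toContinuousLinearMap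

end

/-! The torus part is an area-perimeter argument. Normalise `U`, `V` by `z 0`, `z 1` and sum their
monomials over an `n × n` window. Multiplied by `z i - T i`, where `T = ![U, V]`, this sum
telescopes to two opposite edges. A solution of the first Harte equation therefore bounds the window
sum by its four edge sums, with a constant independent of `n`. Test this on the indicators of a
finite partition and add the `p`-th powers of the norms over the pieces. By freeness the points `θ^j
τ^k x` of a window are almost surely distinct, so a fine enough partition puts them in different
pieces. Coefficients have modulus one, so the total tends to the cardinality of the window
(`tendsto_sum_enorm_windowSum`). In the limit `n * n ≤ D * 4n` for every `n`, which is absurd.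
Summing over all pieces makes a Rokhlin-type tower unnecessary. For the converse, an invertible
Koopman operator and its inverse are both contractions, so its spectrum lies on the circle;
invertibility in one coordinate solves both Harte equations. -/

open Filter Topology

/-! ### Koopman operators and their spectrum in the invertible case. -/

section Koopman

variable {Ω : Type*} [MeasurableSpace Ω] {μ : Measure Ω} {p : ℝ≥0∞} [Fact (1 ≤ p)]

theorem koopman_apply {θ : Ω → Ω} (hθ : MeasurePreserving θ μ μ) (f : Lp ℂ p μ) :
    koopman p hθ f = Lp.compMeasurePreserving θ hθ f := rfl

theorem koopman_mul {θ τ : Ω → Ω} (hθ : MeasurePreserving θ μ μ)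
    (hτ : MeasurePreserving τ μ μ) :
    koopman p hθ * koopman p hτ = koopman p (hτ.comp hθ) := by
  ext1 f
  exact (Lp.compMeasurePreserving_comp_apply f hτ hθ).symm

theorem koopman_congr {θ τ : Ω → Ω} (hθ : MeasurePreserving θ μ μ)
    (hτ : MeasurePreserving τ μ μ) (h : θ =ᵐ[μ] τ) : koopman p hθ = koopman p hτ := by
  ext1 f
  apply Lp.ext
  simp only [koopman_apply]
  filter_upwards [Lp.coeFn_compMeasurePreserving f hθ, Lp.coeFn_compMeasurePreserving f hτ, h]
    with x h1 h2 h3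
  rw [h1, h2, Function.comp_apply, Function.comp_apply, h3]

theorem koopman_id : koopman p (MeasurePreserving.id μ) = 1 := by
  ext1 f
  exact Lp.compMeasurePreserving_id_apply f

theorem koopman_pow {θ : Ω → Ω} (hθ : MeasurePreserving θ μ μ) (n : ℕ) :
    koopman p hθ ^ n = koopman p (hθ.iterate n) := by
  induction n with
  | zero => exact koopman_id.symm
  | succ n ih => rw [pow_succ', ih, koopman_mul]; rfl

theorem koopman_commute {θ τ : Ω → Ω} (hθ : MeasurePreserving θ μ μ)
    (hτ : MeasurePreserving τ μ μ) (h : ∀ᵐ x ∂μ, θ (τ x) = τ (θ x)) :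
    Commute (koopman p hθ) (koopman p hτ) := by
  rw [commute_iff_eq, koopman_mul, koopman_mul]
  refine koopman_congr _ _ ?_
  filter_upwards [h] with x hx using hx.symm

theorem norm_koopman_le {θ : Ω → Ω} (hθ : MeasurePreserving θ μ μ) : ‖koopman p hθ‖ ≤ 1 :=
  LinearIsometry.norm_toContinuousLinearMap_le _

/-- The spectrum of an invertible Koopman operator lies on the unit circle. -/
theorem isUnit_smul_one_sub_koopman {θ : Ω → Ω} (hθ : MeasurePreserving θ μ μ)
    (hinv : IsInvertibleMod μ θ) {z : ℂ} (hz : ‖z‖ ≠ 1) :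
    IsUnit (z • (1 : Lp ℂ p μ →L[ℂ] Lp ℂ p μ) - koopman p hθ) := by
  obtain ⟨η, hη, h1, h2⟩ := hinv
  let u : (Lp ℂ p μ →L[ℂ] Lp ℂ p μ)ˣ :=
    ⟨koopman p hθ, koopman p hη,
      by rw [koopman_mul, ← koopman_id]; exact koopman_congr _ _ h1,
      by rw [koopman_mul, ← koopman_id]; exact koopman_congr _ _ h2⟩
  -- Applied to the operator at `z` and to its inverse at `z⁻¹`, this gives `‖z‖ ≤ 1` and `‖z‖ ≥ 1`.
  have key : ∀ (a : Lp ℂ p μ →L[ℂ] Lp ℂ p μ) (k : ℂ), ‖a‖ ≤ 1 → k ∈ spectrum ℂ a → ‖k‖ ≤ 1 := by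
    intro a k ha hk
    refine (spectrum.norm_le_norm_mul_of_mem hk).trans ?_
    exact mul_le_one₀ ha (norm_nonneg _) ContinuousLinearMap.norm_id_le
  by_contra hns
  have hmem : z ∈ spectrum ℂ (u : Lp ℂ p μ →L[ℂ] Lp ℂ p μ) := by
    rw [spectrum.mem_iff, Algebra.algebraMap_eq_smul_one]
    exact hns
  have hz0 : z ≠ 0 := spectrum.ne_zero_of_mem_of_unit hmem
  have hle : ‖z‖ ≤ 1 := key _ _ (norm_koopman_le hθ) hmem
  have hmem' := (spectrum.inv_mem_iff (r := Units.mk0 z hz0)).1 hmem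
  have hge : ‖z⁻¹‖ ≤ 1 := key (koopman p hη) _ (norm_koopman_le hη) hmem'
  rw [norm_inv] at hge
  have := (inv_le_one₀ (norm_pos_iff.2 hz0)).1 hge
  exact hz (le_antisymm hle this)

end Koopman

/-- A point of the joint spectrum has no coordinate at which the operator is invertible. -/
theorem not_isUnit_of_mem_harteSpectrum {ι : Type*} [Fintype ι] {X : Type*}
    [NormedAddCommGroup X] [NormedSpace ℂ X] {T : ι → X →L[ℂ] X} {z : ι → ℂ}
    (hz : z ∈ harteSpectrum T) (i : ι) : ¬ IsUnit (z i • (1 : X →L[ℂ] X) - T i) := by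
  classical
  rintro ⟨u, hu⟩
  rcases hz with h | h
  · refine h ⟨Pi.single i ↑u⁻¹, ?_⟩
    rw [Finset.sum_eq_single i]
    · simp [← hu]
    · intro j _ hj; simp [hj]
    · simp
  · refine h ⟨Pi.single i ↑u⁻¹, ?_⟩
    rw [Finset.sum_eq_single i]
    · simp [← hu]
    · intro j _ hj; simp [hj]
    · simp

/-! ### Pointwise sums over colours. -/

section Colouring

variable {M I : Type*} [Fintype I] [DecidableEq I]

/-- If the colours `a m`, `m ∈ F`, are distinct, each of them contributes one to the sum. -/
theorem sum_enorm_rpow_eq_card (F : Finset M) (c : M → ℂ) (hc : ∀ m, ‖c m‖ = 1) (a : M → I)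
    {r : ℝ} (hr : 1 ≤ r) (ha : Set.InjOn a F) :
    ∑ i, ‖∑ m ∈ F, c m * (if a m = i then 1 else 0)‖ₑ ^ r = (F.card : ℝ≥0∞) := by
  classical
  have h0 : ∀ i ∉ F.image a, ‖∑ m ∈ F, c m * (if a m = i then 1 else 0)‖ₑ ^ r = 0 := by
    intro i hi
    rw [Finset.sum_eq_zero, enorm_zero, ENNReal.zero_rpow_of_pos (by linarith)]
    intro m hm
    rw [if_neg, mul_zero]
    rintro rfl
    exact hi (Finset.mem_image_of_mem a hm)
  rw [← Finset.sum_subset (Finset.subset_univ (F.image a)) (fun i _ hi => h0 i hi),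
    Finset.sum_image ha, Finset.card_eq_sum_ones, Nat.cast_sum]
  refine Finset.sum_congr rfl fun m hm => ?_
  rw [Finset.sum_eq_single_of_mem m hm]
  · simp [← ofReal_norm, hc]
  · intro m' hm' hne
    rw [if_neg fun h => hne (ha hm' hm h), mul_zero]

/-- Serves as the dominating constant for dominated convergence. It holds by the power-mean
inequality, since each `m` contributes to exactly one colour. -/
theorem sum_enorm_rpow_le (F : Finset M) (c : M → ℂ) (hc : ∀ m, ‖c m‖ = 1) (a : M → I)
    {r : ℝ} (hr : 1 ≤ r) :
    ∑ i, ‖∑ m ∈ F, c m * (if a m = i then 1 else 0)‖ₑ ^ r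
      ≤ (F.card : ℝ≥0∞) ^ (r - 1) * F.card := by
  have hterm : ∀ m i, ‖c m * (if a m = i then 1 else 0)‖ₑ ^ r
      = (if a m = i then (1 : ℝ≥0∞) else 0) := by
    intro m i
    split_ifs
    · simp [← ofReal_norm, hc]
    · simp [ENNReal.zero_rpow_of_pos (show 0 < r by linarith)]
  calc _ ≤ ∑ i, (F.card : ℝ≥0∞) ^ (r - 1) * ∑ m ∈ F, (if a m = i then (1 : ℝ≥0∞) else 0) := by
        refine Finset.sum_le_sum fun i _ => ?_
        refine (ENNReal.rpow_le_rpow (enorm_sum_le _ _) (by linarith)).trans ?_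
        refine (ENNReal.rpow_sum_le_const_mul_sum_rpow _ _ hr).trans_eq ?_
        simp only [hterm]
    _ = _ := by
        rw [← Finset.mul_sum, Finset.sum_comm]
        simp

end Colouring

/-! ### Partitions by itineraries. -/

section Itinerary

variable {Ω : Type*}

/-- The colour of a point: the list of its memberships in the first `K` sets. -/
noncomputable def itinerary (S : ℕ → Set Ω) (K : ℕ) (x : Ω) : Fin K → Bool := by
  classical exact fun k => decide (x ∈ S k)

/-- Finitely many points that are pairwise separated by the sets `S n` have eventually pairwise
distinct colours. -/
theorem eventually_injOn_itinerary {M : Type*} (S : ℕ → Set Ω) (F : Finset M) (y : M → Ω)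
    (h : ∀ m m', m ≠ m' → ∃ n, ¬ (y m ∈ S n ↔ y m' ∈ S n)) :
    ∀ᶠ K in atTop, Set.InjOn (fun m => itinerary S K (y m)) F := by
  classical
  have : ∀ᶠ K in atTop, ∀ m ∈ F, ∀ m' ∈ F, m ≠ m' →
      itinerary S K (y m) ≠ itinerary S K (y m') := by
    refine (Finset.eventually_all F).2 fun m _ => (Finset.eventually_all F).2 fun m' _ => ?_
    by_cases hne : m = m'
    · exact Eventually.of_forall fun _ h' => (h' hne).elim
    obtain ⟨n, hn⟩ := h m m' hne
    filter_upwards [eventually_gt_atTop n] with K hK _ heq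
    have := congrFun heq ⟨n, hK⟩
    simp only [itinerary, decide_eq_decide] at this
    exact hn this
  filter_upwards [this] with K hK m hm m' hm' heq
  by_contra hne
  exact hK m hm m' hm' hne heq

end Itinerary

/-! ### Window sums and telescoping. -/

section Window

variable {Ω : Type*} [MeasurableSpace Ω]

theorem measurable_itinerary {S : ℕ → Set Ω} (hS : ∀ n, MeasurableSet (S n)) (K : ℕ) :
    Measurable (itinerary S K) := by
  classical
  refine measurable_pi_lambda _ fun k => measurable_to_bool ?_
  convert hS k using 1
  ext x
  simp [itinerary]

variable {μ : Measure Ω} {p : ℝ≥0∞} [Fact (1 ≤ p)]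

/-- The polynomial `∑ (ν⁻¹ V)^k (λ⁻¹ U)^j`, `(j, k) ∈ F`, in two operators. -/
noncomputable def windowSum {X : Type*} [NormedAddCommGroup X] [NormedSpace ℂ X]
    (U V : X →L[ℂ] X) (z : Fin 2 → ℂ) (F : Finset (ℕ × ℕ)) : X →L[ℂ] X :=
  ∑ m ∈ F, ((z 1)⁻¹ • V) ^ m.2 * ((z 0)⁻¹ • U) ^ m.1

/-- The window sum factors into two geometric sums; `1 - P` commutes past the one in `Q` and
telescopes the one in `P`. -/
theorem smul_one_sub_mul_windowSum_left {X : Type*} [NormedAddCommGroup X] [NormedSpace ℂ X]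
    {U V : X →L[ℂ] X} (hUV : Commute U V) {z : Fin 2 → ℂ} (hz : z 0 ≠ 0) (n : ℕ) :
    (z 0 • (1 : X →L[ℂ] X) - U) * windowSum U V z (Finset.range n ×ˢ Finset.range n)
      = z 0 • (windowSum U V z ({0} ×ˢ Finset.range n)
        - windowSum U V z ({n} ×ˢ Finset.range n)) := by
  set P := (z 0)⁻¹ • U with hP
  set Q := (z 1)⁻¹ • V with hQ
  have hPQ : Commute P Q := (hUV.smul_left _).smul_right _
  have hU : z 0 • (1 : X →L[ℂ] X) - U = z 0 • (1 - P) := by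
    rw [smul_sub, hP, smul_inv_smul₀ hz]
  have hF : ∀ A B : Finset ℕ, windowSum U V z (A ×ˢ B)
      = (∑ k ∈ B, Q ^ k) * ∑ j ∈ A, P ^ j := by
    intro A B
    rw [windowSum, Finset.sum_product_right, Finset.sum_mul_sum]
  have hc : Commute (1 - P) (∑ k ∈ Finset.range n, Q ^ k) :=
    Commute.sum_right _ _ _ fun k _ => ((Commute.one_left Q).sub_left hPQ).pow_right k
  rw [hF, hF, hF, hU, smul_mul_assoc, ← mul_assoc, hc.eq, mul_assoc, mul_neg_geom_sum]
  simp [mul_sub]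

/-- Here the geometric sum in `Q` already stands on the left, so no commutation is needed. -/
theorem smul_one_sub_mul_windowSum_right {X : Type*} [NormedAddCommGroup X] [NormedSpace ℂ X]
    (U V : X →L[ℂ] X) {z : Fin 2 → ℂ} (hz : z 1 ≠ 0) (n : ℕ) :
    (z 1 • (1 : X →L[ℂ] X) - V) * windowSum U V z (Finset.range n ×ˢ Finset.range n)
      = z 1 • (windowSum U V z (Finset.range n ×ˢ {0})
        - windowSum U V z (Finset.range n ×ˢ {n})) := by
  set P := (z 0)⁻¹ • U with hP
  set Q := (z 1)⁻¹ • V with hQ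
  have hV : z 1 • (1 : X →L[ℂ] X) - V = z 1 • (1 - Q) := by
    rw [smul_sub, hQ, smul_inv_smul₀ hz]
  have hF : ∀ A B : Finset ℕ, windowSum U V z (A ×ˢ B)
      = (∑ k ∈ B, Q ^ k) * ∑ j ∈ A, P ^ j := by
    intro A B
    rw [windowSum, Finset.sum_product_right, Finset.sum_mul_sum]
  rw [hF, hF, hF, hV, smul_mul_assoc, ← mul_assoc, mul_neg_geom_sum]
  simp [sub_mul]

/-- Composition reverses order: `V ^ k * U ^ j` acts as `f ↦ f ∘ θ^[j] ∘ τ^[k]`, matching the points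
in `IsFreeAction`. -/
theorem coeFn_windowSum_indicator [IsFiniteMeasure μ] {θ τ : Ω → Ω}
    (hθ : MeasurePreserving θ μ μ) (hτ : MeasurePreserving τ μ μ) (z : Fin 2 → ℂ)
    (F : Finset (ℕ × ℕ)) {A : Set Ω} (hA : MeasurableSet A) :
    windowSum (koopman p hθ) (koopman p hτ) z F
        (indicatorConstLp p hA (measure_ne_top μ A) (1 : ℂ))
      =ᵐ[μ] fun x => ∑ m ∈ F, ((z 1)⁻¹ ^ m.2 * (z 0)⁻¹ ^ m.1) *
        A.indicator (fun _ => (1 : ℂ)) (θ^[m.1] (τ^[m.2] x)) := by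
  have hterm : ∀ m : ℕ × ℕ,
      (((z 1)⁻¹ • koopman p hτ) ^ m.2 * ((z 0)⁻¹ • koopman p hθ) ^ m.1)
          (indicatorConstLp p hA (measure_ne_top μ A) (1 : ℂ))
        =ᵐ[μ] fun x => ((z 1)⁻¹ ^ m.2 * (z 0)⁻¹ ^ m.1) *
          A.indicator (fun _ => (1 : ℂ)) (θ^[m.1] (τ^[m.2] x)) := by
    intro m
    rw [smul_pow, smul_pow, smul_mul_smul_comm, koopman_pow, koopman_pow, koopman_mul,
      _root_.smul_apply]
    have hmp := (hθ.iterate m.1).comp (hτ.iterate m.2)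
    set e := indicatorConstLp p hA (measure_ne_top μ A) (1 : ℂ) with he
    have h1 : koopman p hmp e =ᵐ[μ] e ∘ _ := Lp.coeFn_compMeasurePreserving e hmp
    have h2 := hmp.quasiMeasurePreserving.ae
      (indicatorConstLp_coeFn (p := p) (hs := hA) (hμs := measure_ne_top μ A) (c := (1 : ℂ)))
    filter_upwards [Lp.coeFn_smul ((z 1)⁻¹ ^ m.2 * (z 0)⁻¹ ^ m.1) (koopman p hmp e), h1, h2]
      with x hx1 hx2 hx3
    rw [hx1, Pi.smul_apply, hx2, smul_eq_mul, Function.comp_apply, he, hx3]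
    rfl
  classical
  induction F using Finset.induction_on with
  | empty =>
    simp only [windowSum, Finset.sum_empty]
    exact Lp.coeFn_zero ℂ p μ
  | insert m F hm ih =>
    rw [windowSum, Finset.sum_insert hm, _root_.add_apply]
    filter_upwards [Lp.coeFn_add ((((z 1)⁻¹ • koopman p hτ) ^ m.2 *
        ((z 0)⁻¹ • koopman p hθ) ^ m.1) (indicatorConstLp p hA (measure_ne_top μ A) (1 : ℂ)))
        (windowSum (koopman p hθ) (koopman p hτ) z F
          (indicatorConstLp p hA (measure_ne_top μ A) (1 : ℂ))), ih, hterm m] with x h1 h2 h3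
    rw [Finset.sum_insert hm, ← h3, ← h2]
    exact h1

end Window

/-! ### Refinement limit and the area-perimeter contradiction. -/

section Main

variable {Ω : Type*} [MeasurableSpace Ω] {μ : Measure Ω} [IsProbabilityMeasure μ]
  {p : ℝ≥0∞} [Fact (1 ≤ p)]

/-- As the partition by itineraries is refined, its translates over a finite window become
disjoint, so that the `p`-th powers of the norms of the window sums add up to the size of the
window. -/
theorem tendsto_sum_enorm_windowSum (hp : p ≠ ∞) {θ τ : Ω → Ω}
    (hθ : MeasurePreserving θ μ μ) (hτ : MeasurePreserving τ μ μ)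
    (hfree : IsFreeAction μ θ τ) {S : ℕ → Set Ω} (hS : ∀ n, MeasurableSet (S n)) {Ω₀ : Set Ω}
    (hΩ₀ : ∀ᵐ x ∂μ, x ∈ Ω₀)
    (hsep : ∀ x ∈ Ω₀, ∀ y ∈ Ω₀, (∀ n, x ∈ S n ↔ y ∈ S n) → x = y)
    {z : Fin 2 → ℂ} (hz0 : ‖z 0‖ = 1) (hz1 : ‖z 1‖ = 1) (F : Finset (ℕ × ℕ)) :
    Tendsto (fun K => ∑ i, ‖windowSum (koopman p hθ) (koopman p hτ) z F
      (indicatorConstLp p (measurable_itinerary hS K (measurableSet_singleton i))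
        (measure_ne_top μ _) (1 : ℂ))‖ₑ ^ p.toReal) atTop (𝓝 (F.card : ℝ≥0∞)) := by
  have hp1 : 1 ≤ p := Fact.out
  have hr : 1 ≤ p.toReal := by
    simpa using (ENNReal.toReal_le_toReal ENNReal.one_ne_top hp).2 hp1
  have hp0 : p ≠ 0 := (zero_lt_one.trans_le hp1).ne'
  set c : ℕ × ℕ → ℂ := fun m => (z 1)⁻¹ ^ m.2 * (z 0)⁻¹ ^ m.1 with hc
  have hc1 : ∀ m, ‖c m‖ = 1 := by intro m; simp [hc, hz0, hz1]
  set G : ℕ → Ω → ℝ≥0∞ := fun K x => ∑ i, ‖∑ m ∈ F, c m *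
    (if itinerary S K (θ^[m.1] (τ^[m.2] x)) = i then 1 else 0)‖ₑ ^ p.toReal with hG
  have hGmeas : ∀ K, Measurable (G K) := by
    intro K
    refine Finset.measurable_sum _ fun i _ => Measurable.pow_const (Measurable.enorm ?_) _
    refine Finset.measurable_sum _ fun m _ => Measurable.const_mul ?_ _
    refine Measurable.ite ?_ measurable_const measurable_const
    exact ((measurable_itinerary hS K).comp ((hθ.measurable.iterate m.1).comp
      (hτ.measurable.iterate m.2))) (measurableSet_singleton i)
  have hGint : ∀ K, ∑ i, ‖windowSum (koopman p hθ) (koopman p hτ) z F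
      (indicatorConstLp p (measurable_itinerary hS K (measurableSet_singleton i))
        (measure_ne_top μ _) (1 : ℂ))‖ₑ ^ p.toReal = ∫⁻ x, G K x ∂μ := by
    intro K
    rw [hG, lintegral_finsetSum']
    · refine Finset.sum_congr rfl fun i _ => ?_
      rw [Lp.enorm_def, eLpNorm_eq_lintegral_rpow_enorm_toReal hp0 hp, one_div,
        ENNReal.rpow_inv_rpow (by linarith)]
      refine lintegral_congr_ae ?_
      filter_upwards [coeFn_windowSum_indicator (p := p) hθ hτ z F
        (measurable_itinerary hS K (measurableSet_singleton i))] with x hx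
      rw [hx]
      simp [Set.indicator, hc]
    · intro i _
      refine Measurable.aemeasurable (Measurable.pow_const (Measurable.enorm ?_) _)
      refine Finset.measurable_sum _ fun m _ => Measurable.const_mul ?_ _
      refine Measurable.ite ?_ measurable_const measurable_const
      exact ((measurable_itinerary hS K).comp ((hθ.measurable.iterate m.1).comp
        (hτ.measurable.iterate m.2))) (measurableSet_singleton i)
  simp only [hGint]
  have hconst : (F.card : ℝ≥0∞) = ∫⁻ _, (F.card : ℝ≥0∞) ∂μ := by simp
  rw [hconst]
  refine tendsto_lintegral_of_dominated_convergence
    (fun _ => (F.card : ℝ≥0∞) ^ (p.toReal - 1) * F.card) hGmeas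
    (fun K => Eventually.of_forall fun x => sum_enorm_rpow_le F c hc1 _ hr) ?_ ?_
  · simp only [lintegral_const, measure_univ, mul_one]
    exact ENNReal.mul_ne_top (ENNReal.rpow_ne_top_of_nonneg (by linarith)
      (ENNReal.natCast_ne_top _)) (ENNReal.natCast_ne_top _)
  · have h1 : ∀ᵐ x ∂μ, ∀ m : ℕ × ℕ, θ^[m.1] (τ^[m.2] x) ∈ Ω₀ := ae_all_iff.2 fun m =>
      ((hθ.iterate m.1).comp (hτ.iterate m.2)).quasiMeasurePreserving.ae hΩ₀
    have h2 : ∀ᵐ x ∂μ, ∀ m n : ℕ × ℕ, m ≠ n →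
        θ^[m.1] (τ^[m.2] x) ≠ θ^[n.1] (τ^[n.2] x) := by
      refine ae_all_iff.2 fun m => ae_all_iff.2 fun n => ?_
      by_cases hmn : m = n
      · exact Eventually.of_forall fun _ h => (h hmn).elim
      · filter_upwards [hfree m n hmn] with x hx _ using hx
    filter_upwards [h1, h2] with x hx1 hx2
    -- At almost every `x` the integrand is eventually constant in `K`.
    refine tendsto_const_nhds.congr' ?_
    filter_upwards [eventually_injOn_itinerary S F (fun m => θ^[m.1] (τ^[m.2] x))
      (fun m m' hne => by
        by_contra! hcon
        exact hx2 m m' hne (hsep _ (hx1 m) _ (hx1 m') hcon))] with K hK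
    exact (sum_enorm_rpow_eq_card F c hc1 _ hr hK).symm

end Main
/-- If the first Harte equation has a solution at a point of the torus, the norm of a window sum
over a square is controlled by the norms of the window sums over its four edges. -/
theorem enorm_windowSum_rpow_le {X : Type*} [NormedAddCommGroup X] [NormedSpace ℂ X]
    {U V : X →L[ℂ] X} (hUV : Commute U V) {z : Fin 2 → ℂ} (hz0 : ‖z 0‖ = 1) (hz1 : ‖z 1‖ = 1)
    {A : Fin 2 → X →L[ℂ] X} (hA : ∑ i, A i * (z i • (1 : X →L[ℂ] X) - ![U, V] i) = 1)
    {r : ℝ} (hr : 1 ≤ r) (n : ℕ) (e : X) :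
    ‖windowSum U V z (Finset.range n ×ˢ Finset.range n) e‖ₑ ^ r ≤
      ((‖A 0‖ₑ + ‖A 1‖ₑ) ^ r * 4 ^ (r - 1)) *
        (‖windowSum U V z ({0} ×ˢ Finset.range n) e‖ₑ ^ r
          + ‖windowSum U V z ({n} ×ˢ Finset.range n) e‖ₑ ^ r
          + ‖windowSum U V z (Finset.range n ×ˢ {0}) e‖ₑ ^ r
          + ‖windowSum U V z (Finset.range n ×ˢ {n}) e‖ₑ ^ r) := by
  have hz0' : z 0 ≠ 0 := by rw [← norm_ne_zero_iff, hz0]; exact one_ne_zero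
  have hz1' : z 1 ≠ 0 := by rw [← norm_ne_zero_iff, hz1]; exact one_ne_zero
  have he0 : ‖z 0‖ₑ = 1 := by simp [← ofReal_norm, hz0]
  have he1 : ‖z 1‖ₑ = 1 := by simp [← ofReal_norm, hz1]
  set W := windowSum U V z (Finset.range n ×ˢ Finset.range n) with hW
  set g₀ := windowSum U V z ({0} ×ˢ Finset.range n) e with hg₀
  set g₁ := windowSum U V z ({n} ×ˢ Finset.range n) e with hg₁
  set g₂ := windowSum U V z (Finset.range n ×ˢ {0}) e with hg₂
  set g₃ := windowSum U V z (Finset.range n ×ˢ {n}) e with hg₃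
  -- Multiply the Harte equation on the right by `W`; telescoping leaves only the edges.
  have hrep : W e = A 0 (z 0 • (g₀ - g₁)) + A 1 (z 1 • (g₂ - g₃)) := by
    have h : W = A 0 * ((z 0 • (1 : X →L[ℂ] X) - U) * W)
        + A 1 * ((z 1 • (1 : X →L[ℂ] X) - V) * W) := by
      rw [← mul_assoc, ← mul_assoc, ← add_mul]
      have hA' : A 0 * (z 0 • (1 : X →L[ℂ] X) - U) + A 1 * (z 1 • (1 : X →L[ℂ] X) - V) = 1 := by
        rwa [Fin.sum_univ_two] at hA
      rw [hA', one_mul]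
    rw [smul_one_sub_mul_windowSum_left hUV hz0', smul_one_sub_mul_windowSum_right U V hz1'] at h
    exact DFunLike.congr_fun h e
  have hop : ∀ (B : X →L[ℂ] X) (x : X), ‖B x‖ₑ ≤ ‖B‖ₑ * ‖x‖ₑ := fun B x => B.le_opENorm x
  have hle : ‖W e‖ₑ ≤ (‖A 0‖ₑ + ‖A 1‖ₑ) * ∑ i, ![‖g₀‖ₑ, ‖g₁‖ₑ, ‖g₂‖ₑ, ‖g₃‖ₑ] i := by
    have h0 : ‖A 0 (z 0 • (g₀ - g₁))‖ₑ ≤ ‖A 0‖ₑ * (‖g₀‖ₑ + ‖g₁‖ₑ) := by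
      refine (hop _ _).trans ?_
      rw [enorm_smul, he0, one_mul]
      gcongr
      exact enorm_sub_le
    have h1 : ‖A 1 (z 1 • (g₂ - g₃))‖ₑ ≤ ‖A 1‖ₑ * (‖g₂‖ₑ + ‖g₃‖ₑ) := by
      refine (hop _ _).trans ?_
      rw [enorm_smul, he1, one_mul]
      gcongr
      exact enorm_sub_le
    rw [hrep]
    refine (enorm_add_le _ _).trans ((add_le_add h0 h1).trans ?_)
    simp only [Fin.sum_univ_four, Matrix.cons_val]
    rw [add_mul, add_assoc (_ + _)]
    exact add_le_add (mul_le_mul_right le_self_add _) (mul_le_mul_right le_add_self _)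
  have hr0 : 0 ≤ r := by linarith
  calc ‖W e‖ₑ ^ r
      ≤ ((‖A 0‖ₑ + ‖A 1‖ₑ) * ∑ i, ![‖g₀‖ₑ, ‖g₁‖ₑ, ‖g₂‖ₑ, ‖g₃‖ₑ] i) ^ r := by gcongr
    -- The factor `4 ^ (r - 1)` is the power-mean constant for four edges.
    _ ≤ (‖A 0‖ₑ + ‖A 1‖ₑ) ^ r * (4 ^ (r - 1) * ∑ i, ![‖g₀‖ₑ, ‖g₁‖ₑ, ‖g₂‖ₑ, ‖g₃‖ₑ] i ^ r) := by
        rw [ENNReal.mul_rpow_of_nonneg _ _ hr0]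
        gcongr
        simpa using ENNReal.rpow_sum_le_const_mul_sum_rpow Finset.univ
          ![‖g₀‖ₑ, ‖g₁‖ₑ, ‖g₂‖ₑ, ‖g₃‖ₑ] hr
    _ = _ := by
        rw [mul_assoc]
        simp only [Fin.sum_univ_four, Matrix.cons_val]

theorem mainTheorem11 {Ω : Type*} [MeasurableSpace Ω] (μ : Measure Ω) [IsProbabilityMeasure μ]
    (hμ : IsNonatomic μ) (hsep : IsCountablySeparatedModNull μ)
    (θ τ : Ω → Ω) (hθ : MeasurePreserving θ μ μ) (hτ : MeasurePreserving τ μ μ)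
    (hcomm : ∀ᵐ x ∂μ, θ (τ x) = τ (θ x)) (hfree : IsFreeAction μ θ τ)
    (p : ℝ≥0∞) [Fact (1 ≤ p)] (hp : p ≠ ∞) :
    {z : Fin 2 → ℂ | ‖z 0‖ = 1 ∧ ‖z 1‖ = 1} ⊆ harteSpectrum ![koopman p hθ, koopman p hτ] ∧
    (IsInvertibleMod μ θ → IsInvertibleMod μ τ →
      harteSpectrum ![koopman p hθ, koopman p hτ] =
        {z : Fin 2 → ℂ | ‖z 0‖ = 1 ∧ ‖z 1‖ = 1}) := by
  have hp1 : 1 ≤ p := Fact.out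
  have hr : 1 ≤ p.toReal := by
    simpa using (ENNReal.toReal_le_toReal ENNReal.one_ne_top hp).2 hp1
  have hsub : {z : Fin 2 → ℂ | ‖z 0‖ = 1 ∧ ‖z 1‖ = 1} ⊆
      harteSpectrum ![koopman p hθ, koopman p hτ] := by
    rintro z ⟨hz0, hz1⟩
    left
    rintro ⟨A, hA⟩
    obtain ⟨Ω₀, hΩ₀, hsepΩ⟩ := hsep
    obtain ⟨S, hS, hSsep⟩ := exists_seq_separating Ω MeasurableSet.empty Ω₀
    set D : ℝ≥0∞ := (‖A 0‖ₑ + ‖A 1‖ₑ) ^ p.toReal * 4 ^ (p.toReal - 1) with hD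
    have hDtop : D ≠ ∞ := by
      refine ENNReal.mul_ne_top (ENNReal.rpow_ne_top_of_nonneg (by linarith) ?_)
        (ENNReal.rpow_ne_top_of_nonneg (by linarith) (by simp))
      exact ENNReal.add_ne_top.2 ⟨enorm_ne_top, enorm_ne_top⟩
    have hlim := fun F => tendsto_sum_enorm_windowSum hp hθ hτ hfree hS hΩ₀ hSsep hz0 hz1 F
    -- The edge estimate is summed over the colours, and then `K → ∞` with `n` fixed.
    have hcard : ∀ n : ℕ, (n : ℝ≥0∞) * n ≤ D * (n + n + n + n) := by
      intro n
      have hlim' := ENNReal.Tendsto.const_mul (a := D)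
        ((((hlim ({0} ×ˢ Finset.range n)).add (hlim ({n} ×ˢ Finset.range n))).add
          (hlim (Finset.range n ×ˢ {0}))).add (hlim (Finset.range n ×ˢ {n}))) (Or.inr hDtop)
      have := le_of_tendsto_of_tendsto' (hlim (Finset.range n ×ˢ Finset.range n)) hlim'
        fun K => by
          rw [← Finset.sum_add_distrib, ← Finset.sum_add_distrib, ← Finset.sum_add_distrib,
            Finset.mul_sum]
          exact Finset.sum_le_sum fun i _ =>
            enorm_windowSum_rpow_le (koopman_commute hθ hτ hcomm) hz0 hz1 hA hr n _
      simpa using this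
    -- Any `n > 4D` contradicts `hcard`.
    obtain ⟨n, hn⟩ := ENNReal.exists_nat_gt (ENNReal.mul_ne_top hDtop (by simp : (4 : ℝ≥0∞) ≠ ∞))
    have hn0 : (n : ℝ≥0∞) ≠ 0 := (zero_le.trans_lt hn).ne'
    refine (ENNReal.mul_lt_mul_left hn0 (ENNReal.natCast_ne_top n) hn).not_ge ?_
    calc (n : ℝ≥0∞) * n ≤ D * (n + n + n + n) := hcard n
      _ = D * 4 * n := by ring
  refine ⟨hsub, fun hθi hτi => Set.Subset.antisymm (fun z hz => ⟨?_, ?_⟩) hsub⟩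
  · by_contra h
    exact not_isUnit_of_mem_harteSpectrum hz 0 (isUnit_smul_one_sub_koopman hθ hθi h)
  · by_contra h
    exact not_isUnit_of_mem_harteSpectrum hz 1 (isUnit_smul_one_sub_koopman hτ hτi h)
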